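/- An MT-space is a set $X$ equipped with a topology and a $\sigma$-algebra (not assumed to be related); measurable laminations are examples. Let $\Gamma$ be a standard unitary ring, i.e. a unitary ring that is a standard Borel space and whose addition, negation and multiplication are measurable. A measurable singular $n$-simplex on $X$ is a map $\sigma:\Delta^n\times T\to X$, with $T$ a standard Borel space, that is measurable for the product $\sigma$-algebra and continuous on every fibre $\Delta^n\times\{t\}$. A singular $n$-cochain $\omega$ of $X$ with values in $\Gamma$ is measurable if $t\mapsto\omega(\sigma|_{\Delta^n\times\{t\}})$ is measurable for every measurable singular $n$-simplex $\sigma$. For $A\subseteq X$ let $C^*_{MT}(X,A,\Gamma)$ be the complex, with the usual singular coboundary, of the measurable cochains that vanish on every singular simplex contained in $A$, and let $H^*_{MT}(X,A,\Gamma)$ be its cohomology. For $U,V\subseteq X$ let $C^*_{MT}(X,U+V,\Gamma)$ be the complex of the measurable cochains that vanish on every singular simplex contained in $U$ or contained in $V$, and let $H^*_{MT}(X,U+V,\Gamma)$ be its cohomology. The inclusion $C^*_{MT}(X,U\cup V,\Gamma)\subseteq C^*_{MT}(X,U+V,\Gamma)$ induces homomorphisms $j:H^k_{MT}(X,U\cup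 V,\Gamma)\to H^k_{MT}(X,U+V,\Gamma)$. **Corollary (relative cup product).** Let $X$ be an MT-space and let $U,V\subseteq X$ be open and measurable. Then $j$ is an isomorphism in every degree $k\ge 0$, and for all $n,m\ge 0$ the usual cup product of cochains induces a well-defined product in measurable relative cohomology: there is a unique biadditive map $$\smile\;:H^n_{MT}(X,U,\Gamma)\times H^m_{MT}(X,V,\Gamma)\to H^{n+m}_{MT}(X,U\cup V,\Gamma)$$ such that, for all cocycles $\omega\in C^n_{MT}(X,U,\Gamma)$ and $\theta\in C^m_{MT}(X,V,\Gamma)$, the cochain $\omega\smile\theta$ is a cocycle of $C^{n+m}_{MT}(X,U+V,\Gamma)$ and $$j\big([\omega]\smile[\theta]\big)=[\omega\smile\theta]\quad\text{in } H^{n+m}_{MT}(X,U+V,\Gamma).$$ -/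

import Mathlib

noncomputable section

namespace MTSpace

/-- The canonical `n`-simplex, with its Euclidean topology and Borel `σ`-algebra. -/
abbrev Simplex (n : ℕ) : Type := stdSimplex ℝ (Fin (n + 1))

/-- The affine map between canonical simplices that sends the `i`-th vertex to the vertex `f i`. -/
def Simplex.affine {k n : ℕ} (f : Fin (k + 1) → Fin (n + 1)) : C(Simplex k, Simplex n) where
  toFun := stdSimplex.map f
  continuous_toFun := stdSimplex.continuous_map f

/-- Usual singular `n`-cochains of `X` with coefficients in `Γ`: the functions on singular
`n`-simplices, i.e. the homomorphisms from the group of singular chains to `Γ`. -/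
abbrev Cochain (X : Type*) [TopologicalSpace X] (Γ : Type*) (n : ℕ) : Type _ :=
  C(Simplex n, X) → Γ

/-- A measurable singular `n`-simplex on an MT-space `X` (a set with a topology and a `σ`-algebra,
unrelated to each other): a map `σ : Δⁿ × T → X`, here written `t ↦ σ(·, t)`, which is measurable
for the product `σ`-algebra and continuous for the product of the topology of `Δⁿ` and the discrete
topology of `T`, i.e. continuous on each fibre `Δⁿ × {t}`. -/
structure MeasurableSimplex (X : Type*) [TopologicalSpace X] [MeasurableSpace X] (n : ℕ)
    (T : Type*) [MeasurableSpace T] where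
  toFun : T → C(Simplex n, X)
  measurable_toFun : Measurable fun p : Simplex n × T => toFun p.2 p.1

/-- A singular cochain `ω` is measurable if `t ↦ ω (σ(·, t))` is measurable for every measurable
singular simplex `σ : Δⁿ × T → X`, where `T` is any standard Borel space. (Every standard Borel
space is isomorphic to one in `Type`.) -/
def IsMeasurableCochain {X : Type*} [TopologicalSpace X] [MeasurableSpace X]
    {Γ : Type*} [MeasurableSpace Γ] {n : ℕ} (ω : Cochain X Γ n) : Prop :=
  ∀ (T : Type) [MeasurableSpace T] [StandardBorelSpace T] (σ : MeasurableSimplex X n T),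
    Measurable fun t => ω (σ.toFun t)

section Complex

variable {X : Type*} [TopologicalSpace X] {Γ : Type*}

/-- The singular coboundary `(δω)(σ) = ∑ᵢ (-1)ⁱ ω(σ ∘ dᵢ)`, with `dᵢ` the `i`-th face. -/
def coboundary [AddCommGroup Γ] (n : ℕ) : Cochain X Γ n →+ Cochain X Γ (n + 1) where
  toFun ω σ := ∑ i : Fin (n + 2), (-1 : ℤ) ^ (i : ℕ) • ω (σ.comp (Simplex.affine i.succAbove))
  map_zero' := by ext σ; simp
  map_add' ω θ := by ext σ; simp [Finset.sum_add_distrib]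

/-- The usual cup product: `(ω ⌣ θ)(σ) = ω(σ|[v₀,…,vₙ]) * θ(σ|[vₙ,…,vₙ₊ₘ])`. -/
def cup [Mul Γ] {n m : ℕ} (ω : Cochain X Γ n) (θ : Cochain X Γ m) : Cochain X Γ (n + m) :=
  fun σ => ω (σ.comp (Simplex.affine (Fin.castLE (by omega)))) *
    θ (σ.comp (Simplex.affine (k := m) (n := n + m) (Fin.natAdd n)))

theorem coboundary_coboundary [AddCommGroup Γ] (n : ℕ) (ω : Cochain X Γ n) :
    coboundary (n + 1) (coboundary n ω) = 0 := by
  funext σ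
  change ∑ i : Fin (n + 3), (-1 : ℤ) ^ (i : ℕ) • ∑ j : Fin (n + 2), (-1 : ℤ) ^ (j : ℕ) •
    ω ((σ.comp (Simplex.affine i.succAbove)).comp (Simplex.affine j.succAbove)) = 0
  simp only [Finset.smul_sum, smul_smul, ← pow_add]
  rw [← Fintype.sum_prod_type']
  refine Finset.sum_involution (fun p _ => (p.1.succAbove p.2, p.2.predAbove p.1))
    (fun ⟨i, j⟩ _ => ?_) (fun ⟨i, j⟩ _ _ h => ?_) (fun _ _ => Finset.mem_univ _)
    (fun ⟨i, j⟩ _ => ?_)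
  · have h : ((σ.comp (Simplex.affine (i.succAbove j).succAbove)).comp
        (Simplex.affine (j.predAbove i).succAbove)) =
        ((σ.comp (Simplex.affine i.succAbove)).comp (Simplex.affine j.succAbove)) := by
      ext x
      simp only [Simplex.affine, ContinuousMap.comp_apply, ContinuousMap.coe_mk,
        stdSimplex.map_comp_apply]
      congr 2
      funext k
      exact Fin.succAbove_succAbove_succAbove_predAbove i j k
    dsimp only
    rw [h, Fin.neg_one_pow_succAbove_add_predAbove, pow_add]
    simp
  · exact Fin.succAbove_ne i j (congrArg Prod.fst h)
  · exact Prod.ext (Fin.succAbove_succAbove_predAbove i j) (Fin.predAbove_predAbove_succAbove i j)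

variable [MeasurableSpace X] [AddCommGroup Γ] [MeasurableSpace Γ]

theorem IsMeasurableCochain.coboundary [MeasurableAdd₂ Γ] [MeasurableNeg Γ] {n : ℕ}
    {ω : Cochain X Γ n} (hω : IsMeasurableCochain ω) :
    IsMeasurableCochain (MTSpace.coboundary n ω) := by
  intro T _ _ σ
  have hz : ∀ (i : ℕ) (f : T → Γ), Measurable f → Measurable fun t => (-1 : ℤ) ^ i • f t := by
    intro i f hf
    rcases neg_one_pow_eq_or ℤ i with h | h
    · simpa [h] using hf
    · simp only [h, neg_smul, one_smul]
      exact hf.neg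
  refine Finset.measurable_fun_sum Finset.univ fun (i : Fin (n + 2)) _ => hz _ _ (hω T
    ⟨fun t => (σ.toFun t).comp (Simplex.affine i.succAbove), ?_⟩)
  exact σ.measurable_toFun.comp
    (((Simplex.affine i.succAbove).continuous.measurable.comp measurable_fst).prodMk measurable_snd)

end Complex

section Cohomology

variable {X : Type*} [TopologicalSpace X] [MeasurableSpace X]
  (Γ : Type*) [AddCommGroup Γ] [MeasurableSpace Γ] [MeasurableAdd₂ Γ] [MeasurableNeg Γ]

/-- The measurable singular cochains of `X` that vanish on every singular simplex contained in
some member of the family `𝒲` of subsets of `X`. -/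
def cochains (𝒲 : Set (Set X)) (n : ℕ) : AddSubgroup (Cochain X Γ n) where
  carrier := {ω | IsMeasurableCochain ω ∧
    ∀ σ : C(Simplex n, X), (∃ W ∈ 𝒲, Set.range σ ⊆ W) → ω σ = 0}
  zero_mem' := ⟨fun _ _ _ _ => measurable_const, fun _ _ => rfl⟩
  add_mem' {ω θ} hω hθ := ⟨fun T _ _ σ => (hω.1 T σ).add (hθ.1 T σ), fun σ h => by
    simp [hω.2 σ h, hθ.2 σ h]⟩
  neg_mem' {ω} hω := ⟨fun T _ _ σ => (hω.1 T σ).neg, fun σ h => by simp [hω.2 σ h]⟩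

/-- Cocycles of the complex `cochains Γ 𝒲`. -/
def cocycles (𝒲 : Set (Set X)) (n : ℕ) : AddSubgroup (Cochain X Γ n) :=
  cochains Γ 𝒲 n ⊓ (coboundary n).ker

/-- Coboundaries of the complex `cochains Γ 𝒲`; there are none but `0` in degree `0`. -/
def coboundaries (𝒲 : Set (Set X)) : (n : ℕ) → AddSubgroup (Cochain X Γ n)
  | 0 => ⊥
  | n + 1 => (cochains Γ 𝒲 n).map (coboundary n)

theorem coboundary_mem_cochains {𝒲 : Set (Set X)} {n : ℕ} {ω : Cochain X Γ n}
    (hω : ω ∈ cochains Γ 𝒲 n) : coboundary n ω ∈ cochains Γ 𝒲 (n + 1) := by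
  refine ⟨hω.1.coboundary, fun σ ⟨W, hW, hσ⟩ => ?_⟩
  change ∑ i : Fin (n + 2), (-1 : ℤ) ^ (i : ℕ) • ω (σ.comp (Simplex.affine i.succAbove)) = 0
  refine Finset.sum_eq_zero fun i _ => ?_
  rw [hω.2 _ ⟨W, hW, Set.range_subset_iff.2 fun x => hσ ⟨_, rfl⟩⟩, smul_zero]

theorem coboundaries_le_cocycles (𝒲 : Set (Set X)) (n : ℕ) :
    coboundaries Γ 𝒲 n ≤ cocycles Γ 𝒲 n := by
  cases n with
  | zero => exact bot_le
  | succ n =>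
    rintro _ ⟨ω, hω, rfl⟩
    exact ⟨coboundary_mem_cochains Γ hω, coboundary_coboundary n ω⟩

/-- The `n`-th cohomology group of the complex `cochains Γ 𝒲`. -/
abbrev Cohomology (𝒲 : Set (Set X)) (n : ℕ) : Type _ :=
  cocycles Γ 𝒲 n ⧸ (coboundaries Γ 𝒲 n).addSubgroupOf (cocycles Γ 𝒲 n)

/-- The measurable relative cohomology group `Hⁿ_MT(X, U, Γ)`. -/
abbrev RelCohomology (U : Set X) (n : ℕ) : Type _ := Cohomology Γ {U} n

/-- The group `Hⁿ_MT(X, U + V, Γ)`: cohomology of the measurable cochains of `X` that vanish on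
the singular simplices contained in `U` and on those contained in `V`. -/
abbrev SumCohomology (U V : Set X) (n : ℕ) : Type _ := Cohomology Γ {U, V} n

variable {Γ}

/-- The cohomology class of a cocycle. -/
def Cohomology.mk {𝒲 : Set (Set X)} {n : ℕ} (ω : cocycles Γ 𝒲 n) : Cohomology Γ 𝒲 n :=
  QuotientAddGroup.mk ω

variable (Γ)

theorem cochains_union_le (U V : Set X) (n : ℕ) : cochains Γ {U ∪ V} n ≤ cochains Γ {U, V} n := by
  rintro ω ⟨hω, h⟩
  refine ⟨hω, fun σ hσ => h σ ⟨U ∪ V, rfl, ?_⟩⟩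
  obtain ⟨W, rfl | rfl, hW⟩ := hσ
  · exact hW.trans Set.subset_union_left
  · exact hW.trans Set.subset_union_right

theorem cocycles_union_le (U V : Set X) (n : ℕ) : cocycles Γ {U ∪ V} n ≤ cocycles Γ {U, V} n :=
  inf_le_inf_right _ (cochains_union_le Γ U V n)

theorem coboundaries_union_le (U V : Set X) (n : ℕ) :
    coboundaries Γ {U ∪ V} n ≤ coboundaries Γ {U, V} n := by
  cases n with
  | zero => exact le_rfl
  | succ n => exact AddSubgroup.map_mono (cochains_union_le Γ U V n)

/-- The homomorphism `Hⁿ_MT(X, U ∪ V, Γ) → Hⁿ_MT(X, U + V, Γ)` induced by the inclusion of the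
cochains vanishing on `U ∪ V` into those vanishing on `U` and on `V`. -/
def unionToSum (U V : Set X) (n : ℕ) :
    RelCohomology Γ (U ∪ V) n →+ SumCohomology Γ U V n :=
  QuotientAddGroup.map _ _ (AddSubgroup.inclusion (cocycles_union_le Γ U V n))
    fun _ hω => coboundaries_union_le Γ U V n hω

end Cohomology

end MTSpace

end

noncomputable section

namespace MTSpace

open FreeAbelianGroup

/-! The heart of the matter is that `j` is an isomorphism. Classically one subdivides each singular
simplex until it is small with respect to `U` and `V`, with a number of subdivisions depending on
the simplex. Here all subdivisions are summed at once, which keeps measurability visible. Let `ι` be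
the fundamental simplex, `sd` barycentric subdivision and `D` its homotopy, `∂D + D∂ = 1 - sd`. For
a cochain `β` vanishing on simplices in `U` or in `V`, set `Pβ(σ) = ∑ᵢ β(σ_* D sdⁱ ι)`
(`primitive`).

If `σ` lies in `U ∪ V`, the Lebesgue number lemma and the shrinking mesh make `sdⁱ ι` small for
large `i`, and `D` preserves smallness, so the sum is finite. If moreover `δβ` vanishes on simplices
in `U ∪ V`, then `δPβ(σ)` telescopes to `β(σ) - β(σ_* sdᴺ ι) = β(σ)` (`coboundary_primitive`). The
chains `D sdⁱ ι` do not depend on `σ`, so `Pβ` is a countable sum of measurable terms and is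
measurable (`measurable_finsum_nat`).

Hence `β - δPβ` vanishes on `U ∪ V` and has the same coboundary as `β`, while `Pβ` still vanishes on
`U` and on `V`. For `β` a cocycle this gives surjectivity of `j`; for `β` a primitive of a cocycle
vanishing on `U ∪ V` it gives injectivity. By the Leibniz rule the cup product descends to classes
with values in `H(X, U + V)`, and composing with `j⁻¹` gives the product; injectivity of `j` makes
it unique. -/

/-! ### Affine simplices of a canonical simplex -/

/-- The affine simplex of `Δᵏ` with vertices `w`. -/
def linearSimplex {n k : ℕ} (w : Fin (n + 1) → Simplex k) : C(Simplex n, Simplex k) where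
  toFun x := ⟨∑ i, x.1 i • (w i).1,
    (convex_stdSimplex ℝ _).sum_mem (fun i _ => x.2.1 i) x.2.2 fun i _ => (w i).2⟩
  continuous_toFun := Continuous.subtype_mk (continuous_finsetSum _ fun i _ =>
    ((continuous_apply i).comp continuous_subtype_val).smul continuous_const) _

theorem linearSimplex_coe {n k : ℕ} (w : Fin (n + 1) → Simplex k) (x : Simplex n) :
    (linearSimplex w x).1 = ∑ i, x.1 i • (w i).1 := rfl

theorem linearSimplex_linearSimplex {n k l : ℕ} (v : Fin (k + 1) → Simplex l)
    (w : Fin (n + 1) → Simplex k) (x : Simplex n) :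
    linearSimplex v (linearSimplex w x) = linearSimplex (linearSimplex v ∘ w) x := by
  apply Subtype.ext
  simp only [linearSimplex_coe, Function.comp_apply, Finset.smul_sum, smul_smul]
  rw [Finset.sum_comm]
  refine Finset.sum_congr rfl fun j _ => ?_
  rw [← Finset.sum_smul]
  congr 1
  change (linearSimplex w x).1 j = _
  rw [linearSimplex_coe, Finset.sum_apply]
  rfl

theorem linearSimplex_vertex_comp {n k : ℕ} (f : Fin (n + 1) → Fin (k + 1)) :
    linearSimplex (fun i => stdSimplex.vertex (f i)) = Simplex.affine f := by
  ext x j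
  change (linearSimplex _ x).1 j = FunOnFinite.linearMap ℝ ℝ f x j
  rw [linearSimplex_coe, Finset.sum_apply, FunOnFinite.linearMap_apply_apply, Finset.sum_filter]
  refine Finset.sum_congr rfl fun i _ => ?_
  simp only [Pi.smul_apply, Pi.single_apply, smul_eq_mul, mul_ite, mul_one, mul_zero,
    @eq_comm _ j]
  rfl

theorem linearSimplex_affine {m n k : ℕ} (w : Fin (n + 1) → Simplex k)
    (f : Fin (m + 1) → Fin (n + 1)) (x : Simplex m) :
    linearSimplex w (Simplex.affine f x) = linearSimplex (w ∘ f) x := by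
  rw [← linearSimplex_vertex_comp, linearSimplex_linearSimplex]
  congr 2
  funext i
  apply Subtype.ext
  simp [linearSimplex_coe, Pi.single_apply]

/-- A set of points of `Δᵏ` which contains every affine simplex with vertices in it. -/
def IsConvexSet {k : ℕ} (K : Set (Simplex k)) : Prop :=
  ∀ ⦃n : ℕ⦄ (w : Fin (n + 1) → Simplex k), (∀ i, w i ∈ K) → ∀ x, linearSimplex w x ∈ K

theorem isConvexSet_preimage {k : ℕ} {C : Set (Fin (k + 1) → ℝ)} (hC : Convex ℝ C) :
    IsConvexSet {p : Simplex k | p.1 ∈ C} :=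
  fun _ _ hw x => hC.sum_mem (fun i _ => x.2.1 i) x.2.2 fun i _ => hw i

theorem isConvexSet_ball {k : ℕ} (p : Simplex k) (r : ℝ) : IsConvexSet (Metric.ball p r) :=
  isConvexSet_preimage (convex_ball p.1 r)

theorem isConvexSet_closedBall {k : ℕ} (p : Simplex k) (r : ℝ) :
    IsConvexSet (Metric.closedBall p r) :=
  isConvexSet_preimage (convex_closedBall p.1 r)

/-- The barycenter of the affine simplex with vertices `w`. -/
def bary {n k : ℕ} (w : Fin (n + 1) → Simplex k) : Simplex k :=
  linearSimplex w stdSimplex.barycenter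

theorem linearSimplex_bary {n k l : ℕ} (v : Fin (k + 1) → Simplex l)
    (w : Fin (n + 1) → Simplex k) :
    linearSimplex v (bary w) = bary (linearSimplex v ∘ w) :=
  linearSimplex_linearSimplex v w _

/-- The difference `bary w - w j` is `1 / (n + 1)` times a sum of only `n` edge vectors, since the
term `i = j` vanishes. -/
theorem dist_bary_le {n k : ℕ} (w : Fin (n + 1) → Simplex k) {d : ℝ}
    (hd : ∀ i j, dist (w i) (w j) ≤ d) (j : Fin (n + 1)) :
    dist (w j) (bary w) ≤ n / (n + 1) * d := by
  have hn : (0 : ℝ) < n + 1 := by positivity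
  have hb : (bary w).1 - (w j).1 =
      ∑ i : Fin n, ((n : ℝ) + 1)⁻¹ • ((w (j.succAbove i)).1 - (w j).1) := by
    have h1 : (bary w).1 = ∑ i, ((n : ℝ) + 1)⁻¹ • (w i).1 := by
      rw [bary, linearSimplex_coe]
      refine Finset.sum_congr rfl fun i _ => ?_
      congr 1
      change (stdSimplex.barycenter : Simplex n).val i = _
      simp
    have h2 : (w j).1 =
        ∑ i : Fin (n + 1), ((n : ℝ) + 1)⁻¹ • (w j).1 := by
      rw [Finset.sum_const, Finset.card_univ, Fintype.card_fin, ← Nat.cast_smul_eq_nsmul ℝ,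
        smul_smul]
      push_cast
      rw [mul_inv_cancel₀ hn.ne', one_smul]
    rw [h1]
    conv_lhs => rw [h2]
    rw [← Finset.sum_sub_distrib, Fin.sum_univ_succAbove _ j, sub_self, zero_add]
    simp only [smul_sub]
  rw [dist_comm, Subtype.dist_eq, dist_eq_norm, hb]
  calc _ ≤ ∑ i : Fin n, ((n : ℝ) + 1)⁻¹ * d := by
        refine norm_sum_le_of_le _ fun i _ => ?_
        rw [norm_smul, Real.norm_of_nonneg (by positivity), ← dist_eq_norm, ← Subtype.dist_eq]
        exact mul_le_mul_of_nonneg_left (hd _ _) (by positivity)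
    _ = _ := by
        rw [Finset.sum_const, Finset.card_univ, Fintype.card_fin, nsmul_eq_mul]
        ring

/-! ### Affine chains, barycentric subdivision and its homotopy -/

/-- Chains of affine simplices with `n` vertices in `Δᵏ` (the augmented affine chain complex,
indexed by the number of vertices). -/
abbrev VertexChain (k n : ℕ) : Type := FreeAbelianGroup (Fin n → Simplex k)

/-- The boundary of affine chains. -/
def bd {k n : ℕ} : VertexChain k (n + 1) →+ VertexChain k n :=
  lift fun w => ∑ i : Fin (n + 1), (-1 : ℤ) ^ (i : ℕ) • of (w ∘ i.succAbove)

/-- The cone of affine chains with apex `b`. -/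
def cone {k n : ℕ} (b : Simplex k) : VertexChain k n →+ VertexChain k (n + 1) :=
  lift fun w => of (Fin.cons b w)

theorem bd_of {k n : ℕ} (w : Fin (n + 1) → Simplex k) :
    bd (of w) = ∑ i : Fin (n + 1), (-1 : ℤ) ^ (i : ℕ) • of (w ∘ i.succAbove) :=
  lift_apply_of _ _

theorem cone_of {k n : ℕ} (b : Simplex k) (w : Fin n → Simplex k) :
    cone b (of w) = of (Fin.cons b w : Fin (n + 1) → Simplex k) :=
  lift_apply_of _ _

theorem bd_bd {k n : ℕ} (c : VertexChain k (n + 2)) : bd (bd c) = 0 := by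
  suffices h : (bd.comp bd : VertexChain k (n + 2) →+ VertexChain k n) = 0 from
    DFunLike.congr_fun h c
  refine lift_ext _ _ fun w => ?_
  rw [AddMonoidHom.comp_apply, bd_of, map_sum]
  simp only [map_zsmul, bd_of, Finset.smul_sum, smul_smul, ← pow_add, AddMonoidHom.zero_apply]
  rw [← Fintype.sum_prod_type']
  refine Finset.sum_involution (fun p _ => (p.1.succAbove p.2, p.2.predAbove p.1))
    (fun ⟨i, j⟩ _ => ?_) (fun ⟨i, j⟩ _ _ h => ?_) (fun _ _ => Finset.mem_univ _)
    (fun ⟨i, j⟩ _ => ?_)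
  · have h : (w ∘ (i.succAbove j).succAbove) ∘ (j.predAbove i).succAbove =
        (w ∘ i.succAbove) ∘ j.succAbove := by
      funext l
      exact congrArg w (Fin.succAbove_succAbove_succAbove_predAbove i j l)
    dsimp only
    rw [h, Fin.neg_one_pow_succAbove_add_predAbove, pow_add]
    simp
  · exact Fin.succAbove_ne i j (congrArg Prod.fst h)
  · exact Prod.ext (Fin.succAbove_succAbove_predAbove i j) (Fin.predAbove_predAbove_succAbove i j)

/-- Lowest degree of the cone formula: the complex is augmented, so the boundary of a vertex is the
empty simplex and there is no correction term. -/
theorem bd_cone_zero {k : ℕ} (b : Simplex k) (c : VertexChain k 0) : bd (cone b c) = c := by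
  suffices h : bd.comp (cone b) = AddMonoidHom.id (VertexChain k 0) from DFunLike.congr_fun h c
  refine lift_ext _ _ fun w => ?_
  rw [AddMonoidHom.comp_apply, cone_of, bd_of]
  rw [Fin.sum_univ_one, Fin.val_zero, pow_zero, one_smul, AddMonoidHom.id_apply]
  exact congrArg of (Subsingleton.elim _ _)

theorem bd_cone_succ {k n : ℕ} (b : Simplex k) (c : VertexChain k (n + 1)) :
    bd (cone b c) = c - cone b (bd c) := by
  suffices h : bd.comp (cone b) =
      AddMonoidHom.id (VertexChain k (n + 1)) - (cone b).comp bd from DFunLike.congr_fun h c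
  refine lift_ext _ _ fun w => ?_
  simp only [AddMonoidHom.comp_apply, AddMonoidHom.sub_apply, AddMonoidHom.id_apply, cone_of,
    bd_of, map_sum, map_zsmul]
  rw [Fin.sum_univ_succ, sub_eq_add_neg, ← Finset.sum_neg_distrib, Fin.val_zero, pow_zero,
    one_smul]
  refine congrArg₂ (· + ·) rfl (Finset.sum_congr rfl fun i _ => ?_)
  · rw [Fin.cons_comp_succ_succAbove, Fin.val_succ, pow_succ, mul_neg_one, neg_smul]
    rfl

/-- Barycentric subdivision of affine chains. -/
def sd {k : ℕ} : (n : ℕ) → VertexChain k n →+ VertexChain k n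
  | 0 => AddMonoidHom.id _
  | n + 1 => lift fun w => cone (bary w) (sd n (bd (of w)))

/-- The chain homotopy between barycentric subdivision and the identity. -/
def sdHomotopy {k : ℕ} : (n : ℕ) → VertexChain k n →+ VertexChain k (n + 1)
  | 0 => 0
  | n + 1 => lift fun w => cone (bary w) (of w - sdHomotopy n (bd (of w)))

theorem sd_succ_of {k n : ℕ} (w : Fin (n + 1) → Simplex k) :
    sd (n + 1) (of w) = cone (bary w) (sd n (bd (of w))) :=
  lift_apply_of _ _

theorem sdHomotopy_succ_of {k n : ℕ} (w : Fin (n + 1) → Simplex k) :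
    sdHomotopy (n + 1) (of w) = cone (bary w) (of w - sdHomotopy n (bd (of w))) :=
  lift_apply_of _ _

theorem bd_sd {k : ℕ} : ∀ (n : ℕ) (c : VertexChain k (n + 1)), bd (sd (n + 1) c) = sd n (bd c) := by
  intro n
  induction n with
  | zero =>
    intro c
    suffices h : bd.comp (sd 1) = (sd 0).comp (bd (k := k)) from DFunLike.congr_fun h c
    refine lift_ext _ _ fun w => ?_
    rw [AddMonoidHom.comp_apply, sd_succ_of, bd_cone_zero]
    rfl
  | succ n ih =>
    intro c
    suffices h : bd.comp (sd (n + 2)) = (sd (n + 1)).comp (bd (k := k)) from DFunLike.congr_fun h c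
    refine lift_ext _ _ fun w => ?_
    rw [AddMonoidHom.comp_apply, sd_succ_of, bd_cone_succ, ih, bd_bd, map_zero, map_zero, sub_zero]
    rfl

/-- By the cone formula it suffices that `w - D∂w - ∂(w - D∂w)` coned off reproduces `sd w`;
induction gives `∂(w - D∂w) = sd ∂w`, whose cone is `sd w`. -/
theorem bd_sdHomotopy {k : ℕ} : ∀ (n : ℕ) (c : VertexChain k (n + 1)),
    bd (sdHomotopy (n + 1) c) = c - sd (n + 1) c - sdHomotopy n (bd c) := by
  intro n
  induction n with
  | zero =>
    intro c
    suffices h : bd.comp (sdHomotopy 1) =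
        AddMonoidHom.id _ - sd 1 - (sdHomotopy 0).comp (bd (k := k)) from DFunLike.congr_fun h c
    refine lift_ext _ _ fun w => ?_
    simp only [AddMonoidHom.comp_apply, AddMonoidHom.sub_apply, AddMonoidHom.id_apply]
    rw [sdHomotopy_succ_of, bd_cone_succ, map_sub, sd_succ_of]
    simp [sdHomotopy, sd]
  | succ n ih =>
    intro c
    suffices h : bd.comp (sdHomotopy (n + 2)) =
        AddMonoidHom.id _ - sd (n + 2) - (sdHomotopy (n + 1)).comp (bd (k := k)) from
      DFunLike.congr_fun h c
    refine lift_ext _ _ fun w => ?_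
    simp only [AddMonoidHom.comp_apply, AddMonoidHom.sub_apply, AddMonoidHom.id_apply]
    rw [sdHomotopy_succ_of, bd_cone_succ, map_sub, ih, bd_bd, map_zero, sub_zero, sub_sub_cancel,
      sd_succ_of]
    abel

/-- Iterated barycentric subdivision. -/
def sdIter {k n : ℕ} : ℕ → VertexChain k n →+ VertexChain k n
  | 0 => AddMonoidHom.id _
  | i + 1 => (sd n).comp (sdIter i)

theorem sdIter_succ {k n : ℕ} (i : ℕ) (c : VertexChain k n) :
    sdIter (i + 1) c = sd n (sdIter i c) := rfl

theorem bd_sdIter {k n : ℕ} (i : ℕ) (c : VertexChain k (n + 1)) :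
    bd (sdIter i c) = sdIter i (bd c) := by
  induction i with
  | zero => rfl
  | succ i ih => rw [sdIter_succ, bd_sd, ih, sdIter_succ]

/-- The chain map induced by an affine simplex. -/
def push {k l : ℕ} (v : Fin (k + 1) → Simplex l) (n : ℕ) : VertexChain k n →+ VertexChain l n :=
  lift fun w => of (linearSimplex v ∘ w)

theorem push_of {k l n : ℕ} (v : Fin (k + 1) → Simplex l) (w : Fin n → Simplex k) :
    push v n (of w) = of (linearSimplex v ∘ w) := lift_apply_of _ _

theorem push_bd {k l n : ℕ} (v : Fin (k + 1) → Simplex l) (c : VertexChain k (n + 1)) :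
    push v n (bd c) = bd (push v (n + 1) c) := by
  suffices h : (push v n).comp bd = bd.comp (push v (n + 1)) from DFunLike.congr_fun h c
  refine lift_ext _ _ fun w => ?_
  simp only [AddMonoidHom.comp_apply, push_of, bd_of, map_sum, map_zsmul]
  rfl

theorem push_cone {k l n : ℕ} (v : Fin (k + 1) → Simplex l) (b : Simplex k) (c : VertexChain k n) :
    push v (n + 1) (cone b c) = cone (linearSimplex v b) (push v n c) := by
  suffices h : (push v (n + 1)).comp (cone b) = (cone (linearSimplex v b)).comp (push v n) from
    DFunLike.congr_fun h c
  refine lift_ext _ _ fun w => ?_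
  simp only [AddMonoidHom.comp_apply, push_of, cone_of]
  rw [Fin.comp_cons]

/-- Naturality, here and for the homotopy, lets a sum attached to a face of `σ` be computed inside
the simplex of `σ` itself. -/
theorem push_sd {k l : ℕ} (v : Fin (k + 1) → Simplex l) : ∀ (n : ℕ) (c : VertexChain k n),
    push v n (sd n c) = sd n (push v n c) := by
  intro n
  induction n with
  | zero => intro c; rfl
  | succ n ih =>
    intro c
    suffices h : (push v (n + 1)).comp (sd (n + 1)) = (sd (n + 1)).comp (push v (n + 1)) from
      DFunLike.congr_fun h c
    refine lift_ext _ _ fun w => ?_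
    simp only [AddMonoidHom.comp_apply]
    rw [sd_succ_of, push_cone, ih, push_bd, push_of, sd_succ_of, linearSimplex_bary]

theorem push_sdHomotopy {k l : ℕ} (v : Fin (k + 1) → Simplex l) : ∀ (n : ℕ) (c : VertexChain k n),
    push v (n + 1) (sdHomotopy n c) = sdHomotopy n (push v n c) := by
  intro n
  induction n with
  | zero => intro c; exact map_zero _
  | succ n ih =>
    intro c
    suffices h : (push v (n + 2)).comp (sdHomotopy (n + 1)) =
        (sdHomotopy (n + 1)).comp (push v (n + 1)) from DFunLike.congr_fun h c
    refine lift_ext _ _ fun w => ?_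
    simp only [AddMonoidHom.comp_apply]
    rw [sdHomotopy_succ_of, push_cone, map_sub, ih, push_bd, push_of, sdHomotopy_succ_of,
      linearSimplex_bary]

theorem push_sdIter {k l n : ℕ} (v : Fin (k + 1) → Simplex l) (i : ℕ) (c : VertexChain k n) :
    push v n (sdIter i c) = sdIter i (push v n c) := by
  induction i with
  | zero => rfl
  | succ i ih => rw [sdIter_succ, push_sd, ih, sdIter_succ]

/-! ### Small chains -/

/-- The chains generated by a set of affine simplices. -/
def chainsIn {k n : ℕ} (S : Set (Fin n → Simplex k)) : AddSubgroup (VertexChain k n) :=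
  AddSubgroup.closure (of '' S)

theorem of_mem_chainsIn {k n : ℕ} {S : Set (Fin n → Simplex k)} {w : Fin n → Simplex k}
    (h : w ∈ S) : of w ∈ chainsIn S :=
  AddSubgroup.subset_closure ⟨w, h, rfl⟩

theorem map_mem_of_mem_chainsIn {k n : ℕ} {S : Set (Fin n → Simplex k)} {G : Type*} [AddCommGroup G]
    (f : VertexChain k n →+ G) {A : AddSubgroup G} (h : ∀ w ∈ S, f (of w) ∈ A)
    {c : VertexChain k n} (hc : c ∈ chainsIn S) : f c ∈ A := by
  refine (AddSubgroup.closure_le (A.comap f)).2 ?_ hc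
  rintro _ ⟨w, hw, rfl⟩
  exact h w hw

theorem chainsIn_mono {k n : ℕ} {S S' : Set (Fin n → Simplex k)} (h : S ⊆ S') :
    chainsIn S ≤ chainsIn S' :=
  AddSubgroup.closure_mono (Set.image_mono h)

theorem bd_of_mem {k n : ℕ} {S : Set (Fin n → Simplex k)} {w : Fin (n + 1) → Simplex k}
    (h : ∀ i : Fin (n + 1), w ∘ i.succAbove ∈ S) : bd (of w) ∈ chainsIn S := by
  rw [bd_of]
  exact sum_mem fun i _ => AddSubgroup.zsmul_mem _ (of_mem_chainsIn (h i)) _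

/-- The homotopy only adds barycenters, which a convex set containing the vertices already contains.
-/
theorem sdHomotopy_of_mem {k : ℕ} {K : Set (Simplex k)} (hK : IsConvexSet K) :
    ∀ (n : ℕ) (w : Fin n → Simplex k), (∀ i, w i ∈ K) →
      sdHomotopy n (of w) ∈ chainsIn {u | ∀ i, u i ∈ K} := by
  intro n
  induction n with
  | zero => intro w _; exact zero_mem _
  | succ n ih =>
    intro w hw
    rw [sdHomotopy_succ_of]
    refine map_mem_of_mem_chainsIn (S := {u | ∀ i, u i ∈ K}) _ (fun u hu => ?_)
      (sub_mem (of_mem_chainsIn hw)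
        (map_mem_of_mem_chainsIn (S := {u | ∀ i, u i ∈ K}) _ ih (bd_of_mem fun i j => hw _)))
    rw [cone_of]
    refine of_mem_chainsIn fun i => ?_
    refine Fin.cases ?_ (fun j => ?_) i
    · exact hK w hw _
    · exact hu j

/-- The clause on convex sets strengthens the induction: it bounds the distance from the new apex to
the vertices coming from the subdivided faces. -/
theorem sd_of_mem {k : ℕ} : ∀ (n : ℕ) (w : Fin n → Simplex k) (d : ℝ),
    (∀ i j, dist (w i) (w j) ≤ d) → sd n (of w) ∈ chainsIn {u : Fin n → Simplex k |
      (∀ i j, dist (u i) (u j) ≤ (n - 1) / n * d) ∧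
        ∀ K, IsConvexSet K → (∀ i, w i ∈ K) → ∀ i, u i ∈ K} := by
  intro n
  induction n with
  | zero => exact fun w d _ => of_mem_chainsIn ⟨fun i => i.elim0, fun _ _ _ i => i.elim0⟩
  | succ n ih =>
    intro w d hd
    have hd0 : 0 ≤ d := dist_nonneg.trans (hd 0 0)
    have hc : ((n + 1 : ℕ) - 1 : ℝ) / (n + 1 : ℕ) = n / (n + 1) := by push_cast; ring
    rw [sd_succ_of, hc]
    refine map_mem_of_mem_chainsIn (S := {u : Fin n → Simplex k |
      (∀ i j, dist (u i) (u j) ≤ (n - 1) / n * d) ∧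
        ∀ K, IsConvexSet K → (∀ i, w i ∈ K) → ∀ i, u i ∈ K}) (cone (bary w)) (fun u hu => ?_) ?_
    · rw [cone_of]
      have hb : ∀ i, dist (u i) (bary w) ≤ n / (n + 1) * d :=
        -- The closed ball around the barycenter is convex and contains all `w i`, hence all
        -- vertices of the subdivided faces.
        hu.2 _ (isConvexSet_closedBall (bary w) _) (dist_bary_le w hd)
      refine of_mem_chainsIn ⟨fun i j => ?_, fun K hK hw i => ?_⟩
      · refine Fin.cases (Fin.cases ?_ (fun j => ?_) j) (fun i => Fin.cases ?_ (fun j => ?_) j) i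
        · simp only [Fin.cons_zero, dist_self]
          positivity
        · simpa [dist_comm] using hb j
        · simpa using hb i
        · simp only [Fin.cons_succ]
          refine (hu.1 i j).trans (mul_le_mul_of_nonneg_right ?_ hd0)
          have : (0 : ℝ) < n := by exact_mod_cast i.pos
          rw [div_le_div_iff₀ this (by positivity)]
          nlinarith
      · refine Fin.cases ?_ (fun j => ?_) i
        · exact hK w hw _
        · exact hu.2 K hK hw j
    · rw [bd_of, map_sum]
      refine sum_mem fun i _ => ?_
      rw [map_zsmul]
      refine AddSubgroup.zsmul_mem _ (chainsIn_mono ?_ (ih (w ∘ i.succAbove) d fun _ _ => hd _ _)) _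
      exact fun u hu => ⟨hu.1, fun K hK hw => hu.2 K hK fun j => hw _⟩

/-- The affine simplices whose vertices are at mutual distance at most `d`. -/
def meshLE (k n : ℕ) (d : ℝ) : Set (Fin n → Simplex k) := {w | ∀ i j, dist (w i) (w j) ≤ d}

theorem sdIter_of_mem {k n : ℕ} (w : Fin n → Simplex k) {d : ℝ} (hw : w ∈ meshLE k n d) (i : ℕ) :
    sdIter i (of w) ∈ chainsIn (meshLE k n (((n - 1) / n : ℝ) ^ i * d)) := by
  induction i with
  | zero => exact of_mem_chainsIn (by simpa using hw)
  | succ i ih =>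
    rw [sdIter_succ]
    refine map_mem_of_mem_chainsIn _ (fun u hu => chainsIn_mono ?_ (sd_of_mem n u _ hu)) ih
    intro v hv
    rw [pow_succ', mul_assoc]
    exact hv.1

theorem exists_forall_sdIter_mem {k n : ℕ} (w : Fin (n + 1) → Simplex k) {ε : ℝ} (hε : 0 < ε) :
    ∃ N, ∀ i, N ≤ i → sdIter i (of w) ∈ chainsIn (meshLE k (n + 1) ε) := by
  have hr : (((n + 1 : ℕ) : ℝ) - 1) / ((n + 1 : ℕ) : ℝ) = n / (n + 1) := by push_cast; ring
  have hr1 : (n : ℝ) / (n + 1) < 1 := by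
    rw [div_lt_one (by positivity)]
    linarith
  have hd : w ∈ meshLE k (n + 1) (Metric.diam (Set.univ : Set (Simplex k))) := fun i j =>
    Metric.dist_le_diam_of_mem isCompact_univ.isBounded (Set.mem_univ _) (Set.mem_univ _)
  have hlim := ((tendsto_pow_atTop_nhds_zero_of_lt_one (by positivity) hr1).mul_const
    (Metric.diam (Set.univ : Set (Simplex k))))
  rw [zero_mul] at hlim
  obtain ⟨N, hN⟩ := Filter.eventually_atTop.1 (hlim.eventually (gt_mem_nhds hε))
  refine ⟨N, fun i hi => chainsIn_mono ?_ (sdIter_of_mem w hd i)⟩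
  intro u hu a b
  rw [hr] at hu
  exact (hu a b).trans (hN i hi).le

/-! ### Measurability of finitely supported sums -/

/-- No limit is taken: `T` splits into countably many measurable pieces on which the sum is a fixed
finite sum, or is `0` by default. -/
theorem measurable_finsum_nat {T Γ : Type*} [MeasurableSpace T] [AddCommMonoid Γ]
    [MeasurableSpace Γ] [MeasurableSingletonClass Γ] [MeasurableAdd₂ Γ] {f : ℕ → T → Γ}
    (hf : ∀ i, Measurable (f i)) : Measurable fun t => ∑ᶠ i, f i t := by
  classical
  have hA : ∀ N, MeasurableSet {t | ∀ i, N ≤ i → f i t = 0} := fun N => by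
    simp only [Set.ofPred_forall]
    exact MeasurableSet.iInter fun i => MeasurableSet.iInter fun _ =>
      hf i (measurableSet_singleton 0)
  -- Index `0` marks infinite support, where `∑ᶠ` is `0`; index `N + 1` marks support below `N`.
  -- Taking the least valid index glues the pieces `g`.
  let p : ℕ → T → Prop := fun
    | 0, t => ¬ ∃ N, ∀ i, N ≤ i → f i t = 0
    | N + 1, t => ∀ i, N ≤ i → f i t = 0
  let g : ℕ → T → Γ := fun
    | 0, _ => 0
    | N + 1, t => ∑ i ∈ Finset.range N, f i t
  have hp : ∀ t, ∃ n, p n t := fun t => by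
    by_cases h : ∃ N, ∀ i, N ≤ i → f i t = 0
    · exact ⟨h.choose + 1, h.choose_spec⟩
    · exact ⟨0, h⟩
  have hg : ∀ n t, p n t → ∑ᶠ i, f i t = g n t := by
    rintro (_ | N) t h
    · refine finsum_of_infinite_support fun hfin => h ?_
      obtain ⟨N, hN⟩ := hfin.bddAbove
      refine ⟨N + 1, fun i hi => ?_⟩
      by_contra hne
      exact absurd (hN hne) (by omega)
    · refine finsum_eq_sum_of_support_subset _ fun i hi => ?_
      by_contra hlt
      exact hi (h i (by simpa using hlt))
  have hfind : (fun t => ∑ᶠ i, f i t) = fun t : T => g (Nat.find (hp t)) t :=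
    funext fun t => hg (Nat.find (hp t)) t (Nat.find_spec (hp t))
  rw [hfind]
  refine Measurable.find ?_ ?_ hp
  · rintro (_ | N)
    · exact measurable_const
    · exact Finset.measurable_fun_sum _ fun i _ => hf i
  · rintro (_ | N)
    · change MeasurableSet {t | ¬ ∃ N, ∀ i, N ≤ i → f i t = 0}
      simp only [← Set.compl_ofPred, Set.ofPred_exists]
      exact (MeasurableSet.iUnion hA).compl
    · exact hA N

/-! ### Evaluation of cochains on affine chains -/

section Eval

variable {X : Type*} [TopologicalSpace X] {Γ : Type*} [AddCommGroup Γ]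

theorem coboundary_apply (n : ℕ) (ω : Cochain X Γ n) (σ : C(Simplex (n + 1), X)) :
    coboundary n ω σ = ∑ i : Fin (n + 2), (-1 : ℤ) ^ (i : ℕ) •
      ω (σ.comp (Simplex.affine i.succAbove)) := rfl

/-- The value of a cochain on the image of an affine chain under a singular simplex. -/
def evalChain {n k : ℕ} (β : Cochain X Γ n) (σ : C(Simplex k, X)) : VertexChain k (n + 1) →+ Γ :=
  lift fun w => β (σ.comp (linearSimplex w))

theorem evalChain_of {n k : ℕ} (β : Cochain X Γ n) (σ : C(Simplex k, X))
    (w : Fin (n + 1) → Simplex k) : evalChain β σ (of w) = β (σ.comp (linearSimplex w)) :=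
  lift_apply_of _ _

/-- Adjointness of `δ` and `∂` turns identities between affine chains into identities between
cochains. -/
theorem evalChain_coboundary {n k : ℕ} (β : Cochain X Γ n) (σ : C(Simplex k, X))
    (c : VertexChain k (n + 2)) : evalChain (coboundary n β) σ c = evalChain β σ (bd c) := by
  suffices h : evalChain (coboundary n β) σ = (evalChain β σ).comp bd from DFunLike.congr_fun h c
  refine lift_ext _ _ fun w => ?_
  rw [AddMonoidHom.comp_apply, bd_of, map_sum, evalChain_of, coboundary_apply]
  refine Finset.sum_congr rfl fun i _ => ?_
  rw [map_zsmul, evalChain_of]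
  congr 2
  ext x
  exact congrArg σ (linearSimplex_affine w i.succAbove x)

theorem evalChain_comp_linearSimplex {n k l : ℕ} (β : Cochain X Γ n) (σ : C(Simplex l, X))
    (v : Fin (k + 1) → Simplex l) (c : VertexChain k (n + 1)) :
    evalChain β (σ.comp (linearSimplex v)) c = evalChain β σ (push v (n + 1) c) := by
  suffices h : evalChain β (σ.comp (linearSimplex v)) = (evalChain β σ).comp (push v (n + 1)) from
    DFunLike.congr_fun h c
  refine lift_ext _ _ fun w => ?_
  rw [AddMonoidHom.comp_apply, push_of, evalChain_of, evalChain_of]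
  congr 1
  ext x
  exact congrArg σ (linearSimplex_linearSimplex v w x)

/-- The composite of a measurable singular simplex with a continuous map of canonical simplices. -/
def MeasurableSimplex.precomp [MeasurableSpace X] {n k : ℕ} {T : Type*} [MeasurableSpace T]
    (σ : MeasurableSimplex X k T) (f : C(Simplex n, Simplex k)) : MeasurableSimplex X n T where
  toFun t := (σ.toFun t).comp f
  measurable_toFun := σ.measurable_toFun.comp
    ((f.continuous.measurable.comp measurable_fst).prodMk measurable_snd)

theorem IsMeasurableCochain.measurable_evalChain [MeasurableSpace X] [MeasurableSpace Γ]
    [MeasurableAdd₂ Γ] [MeasurableNeg Γ] {n k : ℕ} {β : Cochain X Γ n} (hβ : IsMeasurableCochain β)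
    {T : Type} [MeasurableSpace T] [StandardBorelSpace T] (σ : MeasurableSimplex X k T)
    (c : VertexChain k (n + 1)) : Measurable fun t => evalChain β (σ.toFun t) c := by
  have hof : ∀ w, Measurable fun t => evalChain β (σ.toFun t) (of w) := fun w => by
    simp only [evalChain_of]
    exact hβ T (σ.precomp (linearSimplex w))
  induction c using FreeAbelianGroup.induction_on with
  | zero => simpa only [map_zero] using measurable_const
  | of w => exact hof w
  | neg w _ => simp only [map_neg]; exact (hof w).neg
  | add x y hx hy => simp only [map_add]; exact hx.add hy

theorem evalChain_eq_zero {n k : ℕ} {β : Cochain X Γ n} {σ : C(Simplex k, X)}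
    {S : Set (Fin (n + 1) → Simplex k)} (h : ∀ w ∈ S, β (σ.comp (linearSimplex w)) = 0)
    {c : VertexChain k (n + 1)} (hc : c ∈ chainsIn S) : evalChain β σ c = 0 := by
  have : evalChain β σ c ∈ (⊥ : AddSubgroup Γ) :=
    map_mem_of_mem_chainsIn _ (fun w hw => by rw [evalChain_of]; exact h w hw) hc
  exact this

theorem evalChain_eq_zero' {n k : ℕ} {β : Cochain X Γ n} {σ : C(Simplex k, X)}
    (h : ∀ w, β (σ.comp (linearSimplex w)) = 0)
    (c : VertexChain k (n + 1)) : evalChain β σ c = 0 := by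
  have : evalChain β σ = 0 := lift_ext _ _ fun w => by rw [evalChain_of, h]; rfl
  rw [this]
  rfl

/-- The vertices of `Δᵏ`, as an affine chain. -/
def fundamentalChain (k : ℕ) : VertexChain k (k + 1) := of fun i => stdSimplex.vertex i

theorem evalChain_fundamentalChain {n : ℕ} (β : Cochain X Γ n) (σ : C(Simplex n, X)) :
    evalChain β σ (fundamentalChain n) = β σ := by
  rw [fundamentalChain, evalChain_of]
  congr 1
  ext x
  have := linearSimplex_vertex_comp (id : Fin (n + 1) → Fin (n + 1))
  simp only [id] at this
  rw [this]
  exact congrArg σ (stdSimplex.map_id_apply x)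

theorem push_fundamentalChain {k l : ℕ} (f : Fin (k + 1) → Fin (l + 1)) :
    push (fun i => stdSimplex.vertex (f i)) (k + 1) (fundamentalChain k) =
      of fun i => (stdSimplex.vertex (f i) : Simplex l) := by
  rw [fundamentalChain, push_of]
  congr 1
  funext i
  rw [Function.comp_apply, linearSimplex_vertex_comp]
  exact stdSimplex.map_vertex f i

/-! ### Primitives of cochains vanishing on small simplices -/

/-- The affine simplices of `Δᵏ` contained in a convex set that `σ` maps into a member of `𝒲`. -/
def smallSimplices (𝒲 : Set (Set X)) {k : ℕ} (σ : C(Simplex k, X)) (n : ℕ) :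
    Set (Fin n → Simplex k) :=
  -- Keeping `K` in the definition leaves room for the barycenters added by the homotopy.
  {w | ∃ K, IsConvexSet K ∧ (∃ W ∈ 𝒲, K ⊆ σ ⁻¹' W) ∧ ∀ i, w i ∈ K}

/-- Simplices of mesh `ε / 2`, with `ε` a Lebesgue number of the pulled back cover, lie in the
`ε`-ball around their first vertex. -/
theorem exists_sdIter_mem_smallSimplices {𝒲 : Set (Set X)} (h𝒲 : ∀ W ∈ 𝒲, IsOpen W) {k n : ℕ}
    {σ : C(Simplex k, X)} (hσ : Set.range σ ⊆ ⋃₀ 𝒲) (w : Fin (n + 1) → Simplex k) :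
    ∃ N, ∀ i, N ≤ i → sdIter i (of w) ∈ chainsIn (smallSimplices 𝒲 σ (n + 1)) := by
  obtain ⟨ε, hε, hball⟩ := lebesgue_number_lemma_of_metric (s := (Set.univ : Set (Simplex k)))
    (c := fun W : 𝒲 => σ ⁻¹' W) isCompact_univ (fun W => (h𝒲 W W.2).preimage σ.continuous)
    fun x _ => by
      obtain ⟨W, hW, hx⟩ := hσ (Set.mem_range_self x)
      exact Set.mem_iUnion.2 ⟨⟨W, hW⟩, hx⟩
  obtain ⟨N, hN⟩ := exists_forall_sdIter_mem w (half_pos hε)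
  refine ⟨N, fun i hi => chainsIn_mono (fun u hu => ?_) (hN i hi)⟩
  obtain ⟨W, hW⟩ := hball (u 0) (Set.mem_univ _)
  exact ⟨_, isConvexSet_ball (u 0) ε, ⟨W, W.2, hW⟩, fun j =>
    lt_of_le_of_lt (hu j 0) (half_lt_self hε)⟩

variable {𝒲 : Set (Set X)} {n : ℕ} {β : Cochain X Γ n}

theorem evalChain_eq_zero_of_small
    (hβ : ∀ σ : C(Simplex n, X), (∃ W ∈ 𝒲, Set.range σ ⊆ W) → β σ = 0) {k : ℕ}
    {σ : C(Simplex k, X)} {c : VertexChain k (n + 1)}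
    (hc : c ∈ chainsIn (smallSimplices 𝒲 σ (n + 1))) : evalChain β σ c = 0 := by
  refine evalChain_eq_zero (fun w hw => ?_) hc
  obtain ⟨K, hK, ⟨W, hW, hKW⟩, hw⟩ := hw
  exact hβ _ ⟨W, hW, Set.range_subset_iff.2 fun x => hKW (hK w hw x)⟩

theorem sdHomotopy_mem_smallSimplices {k m : ℕ} {σ : C(Simplex k, X)} {c : VertexChain k m}
    (hc : c ∈ chainsIn (smallSimplices 𝒲 σ m)) :
    sdHomotopy m c ∈ chainsIn (smallSimplices 𝒲 σ (m + 1)) := by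
  refine map_mem_of_mem_chainsIn _ (fun w hw => ?_) hc
  obtain ⟨K, hK, hKW, hw⟩ := hw
  have h : {u : Fin (m + 1) → Simplex k | ∀ i, u i ∈ K} ⊆ smallSimplices 𝒲 σ (m + 1) :=
    fun u hu => ⟨K, hK, hKW, hu⟩
  exact chainsIn_mono h (sdHomotopy_of_mem hK m w hw)

/-- A primitive, on the simplices contained in the union of an open cover, of a cocycle which
vanishes on the simplices contained in a member of the cover. -/
def primitive (β : Cochain X Γ (n + 1)) : Cochain X Γ n := fun σ =>
  -- Outside the union of the cover the support may be infinite and the value is then `0`; only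
  -- simplices inside the union matter for the primitive property.
  ∑ᶠ i, evalChain β σ (sdHomotopy (n + 1) (sdIter i (fundamentalChain n)))

theorem primitive_face (β : Cochain X Γ (n + 1)) (σ : C(Simplex (n + 1), X)) (j : Fin (n + 2)) :
    primitive β (σ.comp (Simplex.affine j.succAbove)) = ∑ᶠ i, evalChain β σ
      (sdHomotopy (n + 1) (sdIter i (of ((fun a => stdSimplex.vertex a) ∘ j.succAbove)))) := by
  rw [primitive, ← linearSimplex_vertex_comp]
  simp only [evalChain_comp_linearSimplex, push_sdHomotopy, push_sdIter, push_fundamentalChain]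
  rfl

theorem coboundary_primitive (h𝒲 : ∀ W ∈ 𝒲, IsOpen W) {β : Cochain X Γ (n + 1)}
    (hβ : ∀ σ : C(Simplex (n + 1), X), (∃ W ∈ 𝒲, Set.range σ ⊆ W) → β σ = 0)
    (hδ : ∀ σ : C(Simplex (n + 2), X), Set.range σ ⊆ ⋃₀ 𝒲 → coboundary (n + 1) β σ = 0)
    {σ : C(Simplex (n + 1), X)} (hσ : Set.range σ ⊆ ⋃₀ 𝒲) :
    coboundary n (primitive β) σ = β σ := by
  choose M hM using fun j : Fin (n + 2) => exists_sdIter_mem_smallSimplices h𝒲 hσ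
    ((fun a => stdSimplex.vertex a) ∘ j.succAbove)
  obtain ⟨L, hL⟩ := exists_sdIter_mem_smallSimplices h𝒲 hσ
    (fun a : Fin (n + 2) => stdSimplex.vertex a)
  -- One bound beyond which `σ` and all its faces have small subdivisions.
  set N := max L (Finset.univ.sup M)
  have hface : ∀ j : Fin (n + 2), primitive β (σ.comp (Simplex.affine j.succAbove)) =
      ∑ i ∈ Finset.range N, evalChain β σ (sdHomotopy (n + 1)
        (sdIter i (of ((fun a => stdSimplex.vertex a) ∘ j.succAbove)))) := fun j => by
    rw [primitive_face]
    refine finsum_eq_sum_of_support_subset _ fun i hi => ?_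
    by_contra hlt
    refine hi (evalChain_eq_zero_of_small hβ (sdHomotopy_mem_smallSimplices (hM j i ?_)))
    have h1 : M j ≤ Finset.univ.sup M := Finset.le_sup (Finset.mem_univ j)
    have h2 : N ≤ i := by simpa using hlt
    exact h1.trans ((le_max_right _ _).trans h2)
  -- The homotopy formula with `sdⁱ ∂ = ∂ sdⁱ`; the remaining term `β(∂ D sdⁱ ι) = δβ(D sdⁱ ι)`
  -- vanishes because its simplices lie in the union.
  have hterm : ∀ i, evalChain β σ (sdHomotopy (n + 1) (sdIter i (bd (fundamentalChain (n + 1))))) =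
      evalChain β σ (sdIter i (fundamentalChain (n + 1))) -
        evalChain β σ (sdIter (i + 1) (fundamentalChain (n + 1))) := fun i => by
    have h1 := bd_sdHomotopy (n + 1) (sdIter i (fundamentalChain (n + 1)))
    rw [eq_sub_iff_add_eq, ← eq_sub_iff_add_eq'] at h1
    have h2 : evalChain β σ (bd (sdHomotopy (n + 2) (sdIter i (fundamentalChain (n + 1))))) = 0 := by
      rw [← evalChain_coboundary]
      exact evalChain_eq_zero' (fun w => hδ _ (Set.range_subset_iff.2 fun x => hσ ⟨_, rfl⟩)) _
    rw [← bd_sdIter, h1, map_sub, h2, sub_zero, map_sub, sdIter_succ]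
  calc coboundary n (primitive β) σ
      = ∑ j : Fin (n + 2), (-1 : ℤ) ^ (j : ℕ) • ∑ i ∈ Finset.range N, evalChain β σ
          (sdHomotopy (n + 1) (sdIter i (of ((fun a => stdSimplex.vertex a) ∘ j.succAbove)))) := by
        rw [coboundary_apply]
        exact Finset.sum_congr rfl fun j _ => by rw [hface]
    _ = ∑ i ∈ Finset.range N, evalChain β σ
          (sdHomotopy (n + 1) (sdIter i (bd (fundamentalChain (n + 1))))) := by
        simp only [fundamentalChain, bd_of, map_sum, map_zsmul, Finset.smul_sum]
        exact Finset.sum_comm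
    _ = evalChain β σ (sdIter 0 (fundamentalChain (n + 1))) -
          evalChain β σ (sdIter N (fundamentalChain (n + 1))) := by
        rw [Finset.sum_congr rfl fun i _ => hterm i]
        exact Finset.sum_range_sub' _ _
    _ = β σ := by
        have hN : evalChain β σ (sdIter N (fundamentalChain (n + 1))) = 0 :=
          evalChain_eq_zero_of_small hβ (hL N (le_max_left _ _))
        rw [hN, sub_zero]
        exact evalChain_fundamentalChain β σ

end Eval

/-! ### Excision: comparing `U ∪ V` with `U + V` -/

section Excision

variable {X : Type*} [TopologicalSpace X] [MeasurableSpace X]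
  {Γ : Type*} [AddCommGroup Γ] [MeasurableSpace Γ] [MeasurableAdd₂ Γ] [MeasurableNeg Γ]
  {𝒲 : Set (Set X)}

/-- The chains evaluated are the same for every simplex of a measurable family. For `σ` inside a
member of `𝒲`, every simplex evaluated lies in that member. -/
theorem primitive_mem_cochains [MeasurableSingletonClass Γ] {n : ℕ} {β : Cochain X Γ (n + 1)}
    (hβ : β ∈ cochains Γ 𝒲 (n + 1)) : primitive β ∈ cochains Γ 𝒲 n := by
  refine ⟨fun T _ _ σ => measurable_finsum_nat fun i => hβ.1.measurable_evalChain σ _,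
    fun σ ⟨W, hW, hσ⟩ => ?_⟩
  rw [primitive, ← finsum_zero (M := Γ) (α := ℕ)]
  refine finsum_congr fun i => evalChain_eq_zero' (fun w => hβ.2 _ ⟨W, hW, ?_⟩) _
  exact Set.range_subset_iff.2 fun x => hσ ⟨_, rfl⟩

/-- A `0`-simplex is a single point, so inside the union it lies in one member. -/
theorem mem_cochains_sUnion_zero {β : Cochain X Γ 0} (hβ : β ∈ cochains Γ 𝒲 0) :
    β ∈ cochains Γ {⋃₀ 𝒲} 0 := by
  refine ⟨hβ.1, fun σ ⟨W, hW, hσ⟩ => ?_⟩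
  obtain ⟨x⟩ := (inferInstance : Nonempty (Simplex 0))
  obtain rfl : W = ⋃₀ 𝒲 := hW
  obtain ⟨W, hW, hx⟩ := hσ ⟨x, rfl⟩
  refine hβ.2 σ ⟨W, hW, Set.range_subset_iff.2 fun y => ?_⟩
  rwa [Subsingleton.elim y x]

theorem sub_coboundary_primitive_mem [MeasurableSingletonClass Γ] (h𝒲 : ∀ W ∈ 𝒲, IsOpen W) {n : ℕ}
    {β : Cochain X Γ (n + 1)} (hβ : β ∈ cochains Γ 𝒲 (n + 1))
    (hδ : coboundary (n + 1) β ∈ cochains Γ {⋃₀ 𝒲} (n + 2)) :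
    β - coboundary n (primitive β) ∈ cochains Γ {⋃₀ 𝒲} (n + 1) := by
  refine ⟨(sub_mem hβ (coboundary_mem_cochains Γ (primitive_mem_cochains hβ))).1,
    fun σ ⟨W, hW, hσ⟩ => ?_⟩
  obtain rfl : W = ⋃₀ 𝒲 := hW
  exact sub_eq_zero.2 (coboundary_primitive h𝒲 hβ.2 (fun τ hτ => hδ.2 τ ⟨_, rfl, hτ⟩) hσ).symm

theorem unionToSum_mk (U V : Set X) (n : ℕ) (ω : cocycles Γ {U ∪ V} n) :
    unionToSum Γ U V n (Cohomology.mk ω) =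
      Cohomology.mk (AddSubgroup.inclusion (cocycles_union_le Γ U V n) ω) := rfl

theorem Cohomology.mk_eq_zero_iff {n : ℕ} {ω : cocycles Γ 𝒲 n} :
    Cohomology.mk ω = 0 ↔ (ω : Cochain X Γ n) ∈ coboundaries Γ 𝒲 n :=
  (QuotientAddGroup.eq_zero_iff ω).trans AddSubgroup.mem_addSubgroupOf

theorem Cohomology.mk_surjective {n : ℕ} :
    Function.Surjective (Cohomology.mk : cocycles Γ 𝒲 n → Cohomology Γ 𝒲 n) :=
  QuotientAddGroup.mk_surjective

theorem Cohomology.mk_eq_mk_iff {n : ℕ} {ω θ : cocycles Γ 𝒲 n} :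
    Cohomology.mk ω = Cohomology.mk θ ↔
      (ω : Cochain X Γ n) - (θ : Cochain X Γ n) ∈ coboundaries Γ 𝒲 n := by
  rw [← sub_eq_zero]
  exact Cohomology.mk_eq_zero_iff (ω := ω - θ)

theorem unionToSum_bijective [MeasurableSingletonClass Γ] {U V : Set X} (hU : IsOpen U)
    (hV : IsOpen V) (k : ℕ) : Function.Bijective (unionToSum Γ U V k) := by
  have hop : ∀ W ∈ ({U, V} : Set (Set X)), IsOpen W := by
    rintro W (rfl | rfl)
    exacts [hU, hV]
  have hUV : ⋃₀ ({U, V} : Set (Set X)) = U ∪ V := Set.sUnion_pair U V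
  refine ⟨(injective_iff_map_eq_zero _).2 fun a ha => ?_, fun a => ?_⟩
  · obtain ⟨ω, rfl⟩ := Cohomology.mk_surjective a
    rw [unionToSum_mk, Cohomology.mk_eq_zero_iff] at ha
    rw [Cohomology.mk_eq_zero_iff]
    cases k with
    | zero => exact ha
    | succ k =>
      obtain ⟨η, hη, hηω⟩ := ha
      have hδ : coboundary k η ∈ cochains Γ {U ∪ V} (k + 1) := by
        rw [hηω]
        exact ω.2.1
      rw [← hUV] at hδ
      cases k with
      | zero =>
        refine ⟨η, ?_, hηω⟩
        rw [← hUV]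
        exact mem_cochains_sUnion_zero hη
      | succ k =>
        -- Correcting `η` by a coboundary makes it vanish on `U ∪ V` without changing `δη = ω`.
        refine ⟨η - coboundary k (primitive η), ?_, ?_⟩
        · rw [← hUV]
          exact sub_coboundary_primitive_mem hop hη hδ
        · rw [map_sub, coboundary_coboundary, sub_zero]
          exact hηω
  · obtain ⟨ω, rfl⟩ := Cohomology.mk_surjective a
    cases k with
    | zero =>
      refine ⟨Cohomology.mk ⟨ω, ?_, ω.2.2⟩, rfl⟩
      rw [← hUV]
      exact mem_cochains_sUnion_zero ω.2.1
    | succ k =>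
      obtain ⟨ω, hω, hδω⟩ := ω
      have hδ0 : coboundary (k + 1) ω = 0 := hδω
      have hη := primitive_mem_cochains hω
      have hmem : ω - coboundary k (primitive ω) ∈ cocycles Γ {U ∪ V} (k + 1) := by
        refine AddSubgroup.mem_inf.2 ⟨?_, ?_⟩
        · rw [← hUV]
          refine sub_coboundary_primitive_mem hop hω ?_
          rw [hδ0]
          exact zero_mem _
        · rw [AddMonoidHom.mem_ker, map_sub, hδ0, coboundary_coboundary, sub_zero]
      refine ⟨Cohomology.mk ⟨_, hmem⟩, ?_⟩
      rw [unionToSum_mk, Cohomology.mk_eq_mk_iff]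
      refine ⟨-primitive ω, neg_mem hη, ?_⟩
      rw [map_neg]
      exact (sub_sub_cancel_left ω _).symm

end Excision

/-! ### Cup products -/

section Cup

variable {X : Type*} [TopologicalSpace X] {Γ : Type*} [Ring Γ]

theorem Simplex.affine_affine {m n k : ℕ} (f : Fin (n + 1) → Fin (k + 1))
    (g : Fin (m + 1) → Fin (n + 1)) :
    (Simplex.affine f).comp (Simplex.affine g) = Simplex.affine (f ∘ g) := by
  ext x : 1
  exact stdSimplex.map_comp_apply g f x

theorem cup_apply {n m : ℕ} (ω : Cochain X Γ n) (θ : Cochain X Γ m) (σ : C(Simplex (n + m), X)) :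
    cup ω θ σ = ω (σ.comp (Simplex.affine (Fin.castLE (by omega)))) *
      θ (σ.comp (Simplex.affine (k := m) (n := n + m) (Fin.natAdd n))) := rfl

theorem val_succAbove {n : ℕ} (i : Fin (n + 1)) (j : Fin n) :
    (i.succAbove j : ℕ) = if (j : ℕ) < i then (j : ℕ) else j + 1 := by
  unfold Fin.succAbove
  split_ifs with h1 h2 h2
  · rfl
  · exact absurd h1 h2
  · exact absurd h2 h1
  · rfl

/-- The Leibniz rule. -/
theorem coboundary_cup_apply {n m : ℕ} (ω : Cochain X Γ n) (θ : Cochain X Γ m)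
    (σ : C(Simplex (n + m + 1), X)) :
    coboundary (n + m) (cup ω θ) σ =
      coboundary n ω (σ.comp (Simplex.affine (Fin.castLE (by omega)))) *
        θ (σ.comp (Simplex.affine (k := m) (n := n + m + 1)
          fun i => ⟨n + 1 + i, by omega⟩)) +
      (-1 : ℤ) ^ n • (ω (σ.comp (Simplex.affine (Fin.castLE (by omega)))) *
        coboundary m θ (σ.comp (Simplex.affine (k := m + 1) (n := n + m + 1)
          fun i => ⟨n + i, by omega⟩))) := by
  let F : (Fin (n + 1) → Fin (n + m + 2)) → Γ := fun f => ω (σ.comp (Simplex.affine f))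
  let G : (Fin (m + 1) → Fin (n + m + 2)) → Γ := fun f => θ (σ.comp (Simplex.affine f))
  let front : Fin (n + 2) → Fin (n + m + 2) := Fin.castLE (by omega)
  let back : Fin (m + 2) → Fin (n + m + 2) := fun i => ⟨n + i, by omega⟩
  let front' : Fin (n + 1) → Fin (n + m + 2) := Fin.castLE (by omega)
  let back' : Fin (m + 1) → Fin (n + m + 2) := fun i => ⟨n + 1 + i, by omega⟩
  have hω : coboundary n ω (σ.comp (Simplex.affine front)) =
      ∑ i : Fin (n + 1), (-1 : ℤ) ^ (i : ℕ) • F (front ∘ i.castSucc.succAbove) +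
        (-1 : ℤ) ^ (n + 1) • F front' := by
    rw [coboundary_apply, Fin.sum_univ_castSucc]
    simp only [ContinuousMap.comp_assoc, Simplex.affine_affine, Fin.val_last, Fin.val_castSucc]
    refine congrArg₂ (· + ·) rfl (congrArg ((-1 : ℤ) ^ (n + 1) • ·) (congrArg F (funext fun j => ?_)))
    simp [front, front']
  have hθ : coboundary m θ (σ.comp (Simplex.affine back)) =
      G back' + ∑ i : Fin (m + 1), (-1 : ℤ) ^ (i + 1 : ℕ) • G (back ∘ i.succ.succAbove) := by
    rw [coboundary_apply, Fin.sum_univ_succ]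
    simp only [ContinuousMap.comp_assoc, Simplex.affine_affine, Fin.val_zero, Fin.val_succ,
      pow_zero, one_smul]
    refine congrArg₂ (· + ·) (congrArg G (funext fun j => ?_)) rfl
    simp [back, back', Fin.ext_iff]
    omega
  have hcup : coboundary (n + m) (cup ω θ) σ =
      ∑ i : Fin (n + 1), (-1 : ℤ) ^ (i : ℕ) • (F (front ∘ i.castSucc.succAbove) * G back') +
      ∑ i : Fin (m + 1), (-1 : ℤ) ^ (n + 1 + i : ℕ) • (F front' * G (back ∘ i.succ.succAbove)) := by
    -- The faces are split according to whether the deleted index is at most `n` or larger.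
    have hc : n + 1 + (m + 1) = n + m + 2 := by omega
    rw [coboundary_apply, ← Equiv.sum_comp (finCongr hc), Fin.sum_univ_add]
    simp only [cup_apply, ContinuousMap.comp_assoc, Simplex.affine_affine]
    refine congrArg₂ (· + ·) (Finset.sum_congr rfl fun i _ => ?_)
      (Finset.sum_congr rfl fun i _ => ?_)
    · refine congrArg₂ (fun (a : ℤ) (b : Γ) => a • b) (by simp)
        (congrArg₂ (· * ·) (congrArg F (funext fun j => ?_)) (congrArg G (funext fun j => ?_)))
      · apply Fin.ext
        simp only [front, val_succAbove, Function.comp_apply, finCongr_apply, Fin.val_cast,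
          Fin.val_castLE, Fin.val_castAdd, Fin.val_castSucc]
      · apply Fin.ext
        simp only [back', val_succAbove, Function.comp_apply, finCongr_apply, Fin.val_cast,
          Fin.val_castAdd, Fin.val_natAdd]
        split_ifs <;> omega
    · refine congrArg₂ (fun (a : ℤ) (b : Γ) => a • b) (by simp)
        (congrArg₂ (· * ·) (congrArg F (funext fun j => ?_)) (congrArg G (funext fun j => ?_)))
      · apply Fin.ext
        simp only [front', val_succAbove, Function.comp_apply, finCongr_apply, Fin.val_cast,
          Fin.val_castLE, Fin.val_natAdd]
        split_ifs <;> omega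
      · apply Fin.ext
        simp only [back, val_succAbove, Function.comp_apply, finCongr_apply, Fin.val_cast,
          Fin.val_natAdd, Fin.val_succ]
        split_ifs <;> omega
  change coboundary (n + m) (cup ω θ) σ = coboundary n ω (σ.comp (Simplex.affine front)) * G back' +
    (-1 : ℤ) ^ n • (F front' * coboundary m θ (σ.comp (Simplex.affine back)))
  rw [hcup, hω, hθ, add_mul, mul_add, Finset.sum_mul, Finset.mul_sum, smul_add, Finset.smul_sum]
  simp only [smul_mul_assoc, mul_smul_comm, smul_smul, ← pow_add]
  have hpow : ∀ i : Fin (m + 1), n + ((i : ℕ) + 1) = n + 1 + i := fun i => by omega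
  simp only [hpow]
  -- The last face in `δω` and the first face in `δθ` both give `F front' * G back'`, with opposite
  -- signs `(-1)ⁿ⁺¹` and `(-1)ⁿ`.
  rw [pow_succ (-1 : ℤ) n, mul_neg_one, neg_smul]
  abel

theorem cup_add_left {n m : ℕ} (ω ω' : Cochain X Γ n) (θ : Cochain X Γ m) :
    cup (ω + ω') θ = cup ω θ + cup ω' θ := funext fun _ => add_mul _ _ _

theorem cup_add_right {n m : ℕ} (ω : Cochain X Γ n) (θ θ' : Cochain X Γ m) :
    cup ω (θ + θ') = cup ω θ + cup ω θ' := funext fun _ => mul_add _ _ _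

theorem coboundary_cup_eq_zero {n m : ℕ} {ω : Cochain X Γ n} {θ : Cochain X Γ m}
    (hω : coboundary n ω = 0) (hθ : coboundary m θ = 0) :
    coboundary (n + m) (cup ω θ) = 0 := by
  funext σ
  rw [coboundary_cup_apply, hω, hθ]
  simp

variable [MeasurableSpace X] [MeasurableSpace Γ] {U V : Set X} {n m : ℕ}

theorem IsMeasurableCochain.cup [MeasurableMul₂ Γ] {ω : Cochain X Γ n} {θ : Cochain X Γ m}
    (hω : IsMeasurableCochain ω) (hθ : IsMeasurableCochain θ) :
    IsMeasurableCochain (cup ω θ) :=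
  fun T _ _ σ => (hω T (σ.precomp _)).mul (hθ T (σ.precomp _))

variable [MeasurableAdd₂ Γ] [MeasurableNeg Γ]

/-- The degrees `n + 1 + m` and `n + m + 1` are not definitionally equal; relabelling vertices
replaces transport of cochains. -/
theorem mem_coboundaries_of_cast {𝒲 : Set (Set X)} {p q : ℕ} (h : p = q + 1) {ω : Cochain X Γ p}
    {α : Cochain X Γ q} (hα : α ∈ cochains Γ 𝒲 q)
    (hαω : ∀ σ : C(Simplex (q + 1), X), coboundary q α σ =
      ω (σ.comp (Simplex.affine (Fin.cast (by omega) : Fin (p + 1) → Fin (q + 2))))) :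
    ω ∈ coboundaries Γ 𝒲 p := by
  subst h
  refine ⟨α, hα, funext fun σ => (hαω σ).trans (congrArg ω ?_)⟩
  ext x
  exact congrArg σ (stdSimplex.map_id_apply x)

variable [MeasurableMul₂ Γ]

/-- On a simplex in `U` the front factor vanishes, on one in `V` the back factor. A simplex merely
in `U ∪ V` need not kill either, whence `U + V`. -/
theorem cup_mem_cochains {ω : Cochain X Γ n} {θ : Cochain X Γ m}
    (hω : ω ∈ cochains Γ {U} n) (hθ : θ ∈ cochains Γ {V} m) :
    cup ω θ ∈ cochains Γ {U, V} (n + m) := by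
  refine ⟨hω.1.cup hθ.1, fun σ ⟨W, hW, hσ⟩ => ?_⟩
  rw [cup_apply]
  obtain rfl | rfl := hW
  · rw [hω.2 _ ⟨_, rfl, Set.range_subset_iff.2 fun x => hσ ⟨_, rfl⟩⟩, zero_mul]
  · rw [hθ.2 _ ⟨_, rfl, Set.range_subset_iff.2 fun x => hσ ⟨_, rfl⟩⟩, mul_zero]

theorem cup_mem_cocycles {ω : Cochain X Γ n} {θ : Cochain X Γ m}
    (hω : ω ∈ cocycles Γ {U} n) (hθ : θ ∈ cocycles Γ {V} m) :
    cup ω θ ∈ cocycles Γ {U, V} (n + m) :=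
  ⟨cup_mem_cochains hω.1 hθ.1, coboundary_cup_eq_zero hω.2 hθ.2⟩

theorem cup_mem_coboundaries_left {ω : Cochain X Γ n} {θ : Cochain X Γ m}
    (hω : ω ∈ coboundaries Γ {U} n) (hθ : θ ∈ cocycles Γ {V} m) :
    cup ω θ ∈ coboundaries Γ {U, V} (n + m) := by
  cases n with
  | zero =>
    obtain rfl : ω = 0 := hω
    rw [show cup (0 : Cochain X Γ 0) θ = 0 from funext fun σ => zero_mul _]
    exact zero_mem _
  | succ n =>
    obtain ⟨α, hα, rfl⟩ := hω
    refine mem_coboundaries_of_cast (by omega) (cup_mem_cochains hα hθ.1) fun σ => ?_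
    rw [coboundary_cup_apply, show coboundary m θ = 0 from hθ.2, Pi.zero_apply, mul_zero,
      smul_zero, add_zero, cup_apply]
    simp only [ContinuousMap.comp_assoc, Simplex.affine_affine]
    rfl

theorem cup_mem_coboundaries_right {ω : Cochain X Γ n} {θ : Cochain X Γ m}
    (hω : ω ∈ cocycles Γ {U} n) (hθ : θ ∈ coboundaries Γ {V} m) :
    cup ω θ ∈ coboundaries Γ {U, V} (n + m) := by
  cases m with
  | zero =>
    obtain rfl : θ = 0 := hθ
    rw [show cup ω (0 : Cochain X Γ 0) = 0 from funext fun σ => mul_zero _]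
    exact zero_mem _
  | succ m =>
    obtain ⟨α, hα, rfl⟩ := hθ
    -- The sign cancels the one in the Leibniz rule `δ(ω ⌣ α) = (-1)ⁿ ω ⌣ δα` for a cocycle `ω`.
    refine ⟨(-1 : ℤ) ^ n • cup ω α, AddSubgroup.zsmul_mem _ (cup_mem_cochains hω.1 hα) _,
      funext fun σ => ?_⟩
    rw [map_zsmul, Pi.smul_apply]
    change (-1 : ℤ) ^ n • coboundary (n + m) (cup ω α) σ = _
    rw [coboundary_cup_apply, show coboundary n ω = 0 from hω.2,
      Pi.zero_apply, zero_mul, zero_add, smul_smul, ← pow_add, Even.neg_one_pow ⟨n, rfl⟩, one_smul]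
    rfl

/-- The product `Hⁿ_MT(X, U) × Hᵐ_MT(X, V) → Hⁿ⁺ᵐ_MT(X, U + V)` induced by the cup product. -/
def cupSum (U V : Set X) (n m : ℕ) :
    RelCohomology Γ U n →+ RelCohomology Γ V m →+ SumCohomology Γ U V (n + m) :=
  QuotientAddGroup.lift _
    (AddMonoidHom.mk' (fun ω : cocycles Γ {U} n => QuotientAddGroup.lift _
      (AddMonoidHom.mk' (fun θ : cocycles Γ {V} m =>
          (Cohomology.mk ⟨cup ω θ, cup_mem_cocycles ω.2 θ.2⟩ : SumCohomology Γ U V (n + m)))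
        fun _ _ => congrArg Cohomology.mk (Subtype.ext (cup_add_right _ _ _)))
      fun _ hθ => Cohomology.mk_eq_zero_iff.2
        (cup_mem_coboundaries_right ω.2 (AddSubgroup.mem_addSubgroupOf.1 hθ)))
      fun _ _ => QuotientAddGroup.addMonoidHom_ext _ (AddMonoidHom.ext fun _ =>
        congrArg Cohomology.mk (Subtype.ext (cup_add_left _ _ _))))
    fun _ hω => QuotientAddGroup.addMonoidHom_ext _ (AddMonoidHom.ext fun θ =>
      Cohomology.mk_eq_zero_iff.2
        (cup_mem_coboundaries_left (AddSubgroup.mem_addSubgroupOf.1 hω) θ.2))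

theorem cupSum_mk (ω : cocycles Γ {U} n) (θ : cocycles Γ {V} m) :
    cupSum U V n m (Cohomology.mk ω) (Cohomology.mk θ) =
      Cohomology.mk ⟨cup ω θ, cup_mem_cocycles ω.2 θ.2⟩ := rfl

end Cup

end MTSpace

end

/-! ### The relative cup product -/

theorem mainTheorem11 {X : Type*} [TopologicalSpace X] [MeasurableSpace X]
    {Γ : Type*} [Ring Γ] [MeasurableSpace Γ] [StandardBorelSpace Γ]
    [MeasurableAdd₂ Γ] [MeasurableNeg Γ] [MeasurableMul₂ Γ]
    (U V : Set X) (hU : IsOpen U) (hU' : MeasurableSet U) (hV : IsOpen V) (hV' : MeasurableSet V) :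
    (∀ k : ℕ, Function.Bijective (MTSpace.unionToSum Γ U V k)) ∧
    ∀ n m : ℕ,
      ∃! μ : MTSpace.RelCohomology Γ U n →+
          MTSpace.RelCohomology Γ V m →+ MTSpace.RelCohomology Γ (U ∪ V) (n + m),
        ∀ (ω : MTSpace.cocycles Γ {U} n) (θ : MTSpace.cocycles Γ {V} m),
          ∃ h : MTSpace.cup (ω : MTSpace.Cochain X Γ n) (θ : MTSpace.Cochain X Γ m) ∈
              MTSpace.cocycles Γ {U, V} (n + m),
            MTSpace.unionToSum Γ U V (n + m)
                (μ (MTSpace.Cohomology.mk ω) (MTSpace.Cohomology.mk θ)) =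
              MTSpace.Cohomology.mk ⟨MTSpace.cup ω θ, h⟩ := by
  have hj : ∀ k : ℕ, Function.Bijective (MTSpace.unionToSum Γ U V k) :=
    MTSpace.unionToSum_bijective hU hV
  refine ⟨hj, fun n m => ?_⟩
  let e := AddEquiv.ofBijective (MTSpace.unionToSum Γ U V (n + m)) (hj (n + m))
  let μ : MTSpace.RelCohomology Γ U n →+
      MTSpace.RelCohomology Γ V m →+ MTSpace.RelCohomology Γ (U ∪ V) (n + m) :=
    AddMonoidHom.mk' (fun a => e.symm.toAddMonoidHom.comp (MTSpace.cupSum U V n m a)) fun a b => by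
      rw [map_add]
      exact AddMonoidHom.comp_add _ _ _
  refine ⟨μ, fun ω θ => ⟨MTSpace.cup_mem_cocycles ω.2 θ.2, ?_⟩, fun ν hν => ?_⟩
  · exact (e.apply_symm_apply _).trans (MTSpace.cupSum_mk ω θ)
  · refine AddMonoidHom.ext fun a => AddMonoidHom.ext fun b => ?_
    obtain ⟨ω, rfl⟩ := MTSpace.Cohomology.mk_surjective a
    obtain ⟨θ, rfl⟩ := MTSpace.Cohomology.mk_surjective b
    obtain ⟨h, hνω⟩ := hν ω θ
    -- Every class has a representative, so injectivity of `j` determines the product.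
    exact (hj _).1 (hνω.trans ((e.apply_symm_apply _).trans (MTSpace.cupSum_mk ω θ)).symm)
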